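/- Let $k$ be a field, $n\ge 0$ an integer and $F\in GL(n,k)$. Let $H(F)$ be the unital $k$-algebra with generators $u_{ij},v_{ij}$ ($1\le i,j\le n$) and relations $$u\,{}^t v={}^t v\,u=I_n,\qquad vF\,{}^t uF^{-1}=F\,{}^t uF^{-1}v=I_n,\qquad u=(u_{ij}),\ v=(v_{ij}),$$ which is a Hopf algebra with $\Delta(u_{ij})=\sum_l u_{il}\otimes u_{lj}$, $\Delta(v_{ij})=\sum_l v_{il}\otimes v_{lj}$, $\varepsilon(u_{ij})=\varepsilon(v_{ij})=\delta_{ij}$, $S(u)={}^t v$, $S(v)=F\,{}^t uF^{-1}$. A matrix $G\in GL(n,K)$ over a field $K$ is called normalizable over $K$ if there is $\lambda\in K^*$ with ${\rm tr}(\lambda G)={\rm tr}((\lambda G)^{-1})$. A Hopf algebra is called cosemisimple if it is the direct sum of simple subcoalgebras (nonzero subcoalgebras that have no subcoalgebras other than $0$ and themselves). Corollary 2.7. Let $K$ be an algebraically closed field containing $k$ (for instance $K=k$ if $k$ is algebraically closed). If $F$ is not normalizable over $K$, then the Hopf algebra $H(F)$ (over $k$) is not cosemisimple. -/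

import Mathlib

open scoped TensorProduct Matrix

noncomputable section

namespace Cosovereign

universe u v

section Algebra

variable {k : Type u} [Field k] {n : ℕ}

/-- The scalar matrix `M`, viewed as a matrix with entries in a `k`-algebra `A`. -/
abbrev scal (A : Type*) [Ring A] [Algebra k A] (M : Matrix (Fin n) (Fin n) k) :
    Matrix (Fin n) (Fin n) A :=
  M.map (algebraMap k A)

/-- The matrices `u`, `v` over the algebra `A` satisfy the defining relations
`u ᵗv = ᵗv u = 1` and `v F ᵗu F⁻¹ = F ᵗu F⁻¹ v = 1`. -/
structure Relations (F : GL (Fin n) k) {A : Type*} [Ring A] [Algebra k A]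
    (u v : Matrix (Fin n) (Fin n) A) : Prop where
  u_vt : u * vᵀ = 1
  vt_u : vᵀ * u = 1
  v_FuF : v * (scal A F.val * uᵀ * scal A (F⁻¹).val) = 1
  FuF_v : (scal A F.val * uᵀ * scal A (F⁻¹).val) * v = 1

/-- The index set of the generators: `Sum.inl (i, j)` stands for `u i j` and
`Sum.inr (i, j)` for `v i j`. -/
abbrev Gen (n : ℕ) : Type := (Fin n × Fin n) ⊕ (Fin n × Fin n)

/-- The matrix of free generators `u i j`. -/
def freeU (k : Type u) [Field k] (n : ℕ) : Matrix (Fin n) (Fin n) (FreeAlgebra k (Gen n)) :=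
  Matrix.of fun i j => FreeAlgebra.ι k (Sum.inl (i, j))

/-- The matrix of free generators `v i j`. -/
def freeV (k : Type u) [Field k] (n : ℕ) : Matrix (Fin n) (Fin n) (FreeAlgebra k (Gen n)) :=
  Matrix.of fun i j => FreeAlgebra.ι k (Sum.inr (i, j))

/-- The defining relations, entry by entry, on the free algebra. -/
inductive Rel (F : GL (Fin n) k) : FreeAlgebra k (Gen n) → FreeAlgebra k (Gen n) → Prop
  | u_vt (i j : Fin n) : Rel F ((freeU k n * (freeV k n)ᵀ) i j)
      ((1 : Matrix (Fin n) (Fin n) (FreeAlgebra k (Gen n))) i j)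
  | vt_u (i j : Fin n) : Rel F (((freeV k n)ᵀ * freeU k n) i j)
      ((1 : Matrix (Fin n) (Fin n) (FreeAlgebra k (Gen n))) i j)
  | v_FuF (i j : Fin n) : Rel F
      ((freeV k n * (scal (FreeAlgebra k (Gen n)) F.val * (freeU k n)ᵀ *
        scal (FreeAlgebra k (Gen n)) (F⁻¹).val)) i j)
      ((1 : Matrix (Fin n) (Fin n) (FreeAlgebra k (Gen n))) i j)
  | FuF_v (i j : Fin n) : Rel F
      (((scal (FreeAlgebra k (Gen n)) F.val * (freeU k n)ᵀ *
        scal (FreeAlgebra k (Gen n)) (F⁻¹).val) * freeV k n) i j)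
      ((1 : Matrix (Fin n) (Fin n) (FreeAlgebra k (Gen n))) i j)

/-- The universal cosovereign Hopf algebra `H(F)`, as an algebra: the free algebra on the
`u i j` and `v i j` divided by the defining relations. -/
def H (F : GL (Fin n) k) : Type u := RingQuot (Rel F)

variable (F : GL (Fin n) k)

instance : Ring (H F) := inferInstanceAs (Ring (RingQuot (Rel F)))

instance : Algebra k (H F) := inferInstanceAs (Algebra k (RingQuot (Rel F)))

/-- The quotient map. -/
def mk : FreeAlgebra k (Gen n) →ₐ[k] H F := RingQuot.mkAlgHom k (Rel F)

/-- The multiplicative matrix `u` of `H(F)`. -/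
def uMat : Matrix (Fin n) (Fin n) (H F) := (freeU k n).map (mk F)

/-- The multiplicative matrix `v` of `H(F)`. -/
def vMat : Matrix (Fin n) (Fin n) (H F) := (freeV k n).map (mk F)

variable {F}

theorem scal_map {A B : Type*} [Ring A] [Algebra k A] [Ring B] [Algebra k B] (f : A →ₐ[k] B)
    (M : Matrix (Fin n) (Fin n) k) : (scal A M).map f = scal B M := by
  ext i j; simp

theorem one_map' {A B : Type*} [Ring A] [Algebra k A] [Ring B] [Algebra k B] (f : A →ₐ[k] B) :
    (1 : Matrix (Fin n) (Fin n) A).map f = 1 :=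
  Matrix.map_one _ (map_zero f) (map_one f)

theorem relations_uv (F : GL (Fin n) k) : Relations F (uMat F) (vMat F) := by
  have key : ∀ X : Matrix (Fin n) (Fin n) (FreeAlgebra k (Gen n)),
      (∀ i j, Rel F (X i j) ((1 : Matrix (Fin n) (Fin n) (FreeAlgebra k (Gen n))) i j)) →
      X.map (mk F) = 1 := by
    intro X hX
    rw [← one_map' (mk F)]
    ext i j
    exact RingQuot.mkAlgHom_rel k (hX i j)
  refine ⟨?_, ?_, ?_, ?_⟩
  · simpa only [Matrix.map_mul, Matrix.transpose_map, uMat, vMat] using key _ (Rel.u_vt (F := F))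
  · simpa only [Matrix.map_mul, Matrix.transpose_map, uMat, vMat] using key _ (Rel.vt_u (F := F))
  · simpa only [Matrix.map_mul, Matrix.transpose_map, scal_map, uMat, vMat] using key _ (Rel.v_FuF (F := F))
  · simpa only [Matrix.map_mul, Matrix.transpose_map, scal_map, uMat, vMat] using key _ (Rel.FuF_v (F := F))

theorem Relations.map {A B : Type*} [Ring A] [Algebra k A] [Ring B] [Algebra k B]
    {x y : Matrix (Fin n) (Fin n) A} (h : Relations F x y) (f : A →ₐ[k] B) :
    Relations F (x.map f) (y.map f) := by
  refine ⟨?_, ?_, ?_, ?_⟩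
  · simpa only [Matrix.map_mul, Matrix.transpose_map, one_map'] using
      congrArg (fun M => M.map f) h.u_vt
  · simpa only [Matrix.map_mul, Matrix.transpose_map, one_map'] using
      congrArg (fun M => M.map f) h.vt_u
  · simpa only [Matrix.map_mul, Matrix.transpose_map, one_map', scal_map] using
      congrArg (fun M => M.map f) h.v_FuF
  · simpa only [Matrix.map_mul, Matrix.transpose_map, one_map', scal_map] using
      congrArg (fun M => M.map f) h.FuF_v

section Lift

variable {A : Type*} [Ring A] [Algebra k A] {x y : Matrix (Fin n) (Fin n) A}

/-- The morphism from the free algebra sending the generators to the entries of `x` and `y`. -/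
def freeLift (x y : Matrix (Fin n) (Fin n) A) : FreeAlgebra k (Gen n) →ₐ[k] A :=
  FreeAlgebra.lift k (Sum.elim (fun p => x p.1 p.2) (fun p => y p.1 p.2))

theorem freeLift_U (x y : Matrix (Fin n) (Fin n) A) :
    (freeU k n).map (freeLift (k := k) x y) = x := by
  ext i j; simp [freeU, freeLift]

theorem freeLift_V (x y : Matrix (Fin n) (Fin n) A) :
    (freeV k n).map (freeLift (k := k) x y) = y := by
  ext i j; simp [freeV, freeLift]

theorem freeLift_rel (h : Relations F x y) ⦃a b : FreeAlgebra k (Gen n)⦄ (hab : Rel F a b) :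
    freeLift (k := k) x y a = freeLift (k := k) x y b := by
  have key : ∀ X : Matrix (Fin n) (Fin n) (FreeAlgebra k (Gen n)),
      X.map (freeLift (k := k) x y) = 1 → ∀ i j, freeLift (k := k) x y (X i j) =
        freeLift (k := k) x y ((1 : Matrix (Fin n) (Fin n) (FreeAlgebra k (Gen n))) i j) := by
    intro X hX i j
    rw [← one_map' (freeLift (k := k) x y)] at hX
    exact congrFun (congrFun hX i) j
  cases hab with
  | u_vt i j =>
    refine key _ ?_ i j
    simpa only [Matrix.map_mul, Matrix.transpose_map, freeLift_U, freeLift_V] using h.u_vt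
  | vt_u i j =>
    refine key _ ?_ i j
    simpa only [Matrix.map_mul, Matrix.transpose_map, freeLift_U, freeLift_V] using h.vt_u
  | v_FuF i j =>
    refine key _ ?_ i j
    simpa only [Matrix.map_mul, Matrix.transpose_map, freeLift_U, freeLift_V, scal_map] using
      h.v_FuF
  | FuF_v i j =>
    refine key _ ?_ i j
    simpa only [Matrix.map_mul, Matrix.transpose_map, freeLift_U, freeLift_V, scal_map] using
      h.FuF_v

/-- The universal property of the algebra `H(F)`. -/
def lift (h : Relations F x y) : H F →ₐ[k] A :=
  RingQuot.liftAlgHom k ⟨freeLift x y, freeLift_rel h⟩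

theorem lift_mk (h : Relations F x y) (a : FreeAlgebra k (Gen n)) :
    lift h (mk F a) = freeLift x y a :=
  RingQuot.liftAlgHom_mkAlgHom_apply k _ _ a

theorem lift_u (h : Relations F x y) (i j : Fin n) : lift h (uMat F i j) = x i j := by
  simp [uMat, lift_mk, freeU, freeLift]

theorem lift_v (h : Relations F x y) (i j : Fin n) : lift h (vMat F i j) = y i j := by
  simp [vMat, lift_mk, freeV, freeLift]

theorem hom_ext {f g : H F →ₐ[k] A} (hu : ∀ i j, f (uMat F i j) = g (uMat F i j))
    (hv : ∀ i j, f (vMat F i j) = g (vMat F i j)) : f = g := by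
  refine RingQuot.ringQuot_ext' k f g ?_
  refine FreeAlgebra.hom_ext (funext ?_)
  rintro (⟨i, j⟩ | ⟨i, j⟩)
  · exact hu i j
  · exact hv i j

end Lift

/-- Induction on `H(F)`: it is generated as an algebra by the `u i j` and `v i j`. -/
theorem induction_on {P : H F → Prop} (a : H F) (hs : ∀ r : k, P (algebraMap k _ r))
    (hu : ∀ i j, P (uMat F i j)) (hv : ∀ i j, P (vMat F i j))
    (hadd : ∀ a b, P a → P b → P (a + b)) (hmul : ∀ a b, P a → P b → P (a * b)) : P a := by
  obtain ⟨x, rfl⟩ : ∃ x, mk F x = a := RingQuot.mkAlgHom_surjective k (Rel F) a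
  induction x using FreeAlgebra.induction with
  | grade0 r => simpa using hs r
  | grade1 g =>
    rcases g with ⟨i, j⟩ | ⟨i, j⟩
    · exact hu i j
    · exact hv i j
  | mul a b ha hb => rw [map_mul]; exact hmul _ _ ha hb
  | add a b ha hb => rw [map_add]; exact hadd _ _ ha hb

/-! ### The comultiplication and the counit -/

theorem scal_mul_scal_inv (A : Type*) [Ring A] [Algebra k A] (F : GL (Fin n) k) :
    scal A F.val * scal A (F⁻¹).val = 1 := by
  rw [← Matrix.map_mul, ← Units.val_mul, mul_inv_cancel]
  exact Matrix.map_one _ (map_zero _) (map_one _)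

theorem scal_inv_mul_scal (A : Type*) [Ring A] [Algebra k A] (F : GL (Fin n) k) :
    scal A (F⁻¹).val * scal A F.val = 1 := by
  rw [← Matrix.map_mul, ← Units.val_mul, inv_mul_cancel]
  exact Matrix.map_one _ (map_zero _) (map_one _)

theorem transpose_mul_of_commute {A : Type*} [Ring A] (x y : Matrix (Fin n) (Fin n) A)
    (h : ∀ i j a b, Commute (x i j) (y a b)) : (x * y)ᵀ = yᵀ * xᵀ := by
  ext i j
  simp only [Matrix.transpose_apply, Matrix.mul_apply]
  exact Finset.sum_congr rfl fun c _ => h _ _ _ _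

theorem Relations.mul {A : Type*} [Ring A] [Algebra k A] {x y x' y' : Matrix (Fin n) (Fin n) A}
    (h : Relations F x y) (h' : Relations F x' y')
    (hx : ∀ i j a b, Commute (x i j) (x' a b)) (hy : ∀ i j a b, Commute (y i j) (y' a b)) :
    Relations F (x * x') (y * y') := by
  refine ⟨?_, ?_, ?_, ?_⟩
  · rw [transpose_mul_of_commute _ _ hy,
      show x * x' * (y'ᵀ * yᵀ) = x * (x' * y'ᵀ) * yᵀ by simp only [mul_assoc],
      h'.u_vt, mul_one, h.u_vt]
  · rw [transpose_mul_of_commute _ _ hy,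
      show y'ᵀ * yᵀ * (x * x') = y'ᵀ * (yᵀ * x) * x' by simp only [mul_assoc],
      h.vt_u, mul_one, h'.vt_u]
  · rw [transpose_mul_of_commute _ _ hx]
    have e : scal A F.val * (x'ᵀ * xᵀ) * scal A (F⁻¹).val =
        (scal A F.val * x'ᵀ * scal A (F⁻¹).val) * (scal A F.val * xᵀ * scal A (F⁻¹).val) := by
      calc _ = scal A F.val * x'ᵀ * 1 * xᵀ * scal A (F⁻¹).val := by simp only [mul_assoc, one_mul]
        _ = _ := by rw [← scal_inv_mul_scal A F]; simp only [mul_assoc]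
    rw [e, mul_assoc, ← mul_assoc y', h'.v_FuF, one_mul, h.v_FuF]
  · rw [transpose_mul_of_commute _ _ hx]
    have e : scal A F.val * (x'ᵀ * xᵀ) * scal A (F⁻¹).val =
        (scal A F.val * x'ᵀ * scal A (F⁻¹).val) * (scal A F.val * xᵀ * scal A (F⁻¹).val) := by
      calc _ = scal A F.val * x'ᵀ * 1 * xᵀ * scal A (F⁻¹).val := by simp only [mul_assoc, one_mul]
        _ = _ := by rw [← scal_inv_mul_scal A F]; simp only [mul_assoc]
    rw [e, mul_assoc, ← mul_assoc _ y, h.FuF_v, one_mul, h'.FuF_v]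

/-- `a ↦ a ⊗ 1`. -/
abbrev inL (F : GL (Fin n) k) : H F →ₐ[k] H F ⊗[k] H F := Algebra.TensorProduct.includeLeft

/-- `a ↦ 1 ⊗ a`. -/
abbrev inR (F : GL (Fin n) k) : H F →ₐ[k] H F ⊗[k] H F := Algebra.TensorProduct.includeRight

theorem relations_comul (F : GL (Fin n) k) :
    Relations F ((uMat F).map (inL F) * (uMat F).map (inR F))
      ((vMat F).map (inL F) * (vMat F).map (inR F)) :=
  ((relations_uv F).map (inL F)).mul ((relations_uv F).map (inR F))
    (fun _ _ _ _ => by simp [Commute, SemiconjBy])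
    (fun _ _ _ _ => by simp [Commute, SemiconjBy])

/-- The comultiplication, `u i j ↦ ∑ₗ u i l ⊗ u l j` and `v i j ↦ ∑ₗ v i l ⊗ v l j`. -/
def comulHom (F : GL (Fin n) k) : H F →ₐ[k] H F ⊗[k] H F := lift (relations_comul F)

theorem relations_counit (F : GL (Fin n) k) :
    Relations F (1 : Matrix (Fin n) (Fin n) k) (1 : Matrix (Fin n) (Fin n) k) := by
  refine ⟨by simp, by simp, ?_, ?_⟩
  · rw [Matrix.transpose_one, mul_one, one_mul, scal_mul_scal_inv]
  · rw [Matrix.transpose_one, mul_one, mul_one, scal_mul_scal_inv]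

/-- The counit, `u i j ↦ δ i j` and `v i j ↦ δ i j`. -/
def counitHom (F : GL (Fin n) k) : H F →ₐ[k] k := lift (relations_counit F)

theorem comulHom_u (i j : Fin n) :
    comulHom F (uMat F i j) = ∑ l, uMat F i l ⊗ₜ[k] uMat F l j := by
  simp [comulHom, lift_u, Matrix.mul_apply]

theorem comulHom_v (i j : Fin n) :
    comulHom F (vMat F i j) = ∑ l, vMat F i l ⊗ₜ[k] vMat F l j := by
  simp [comulHom, lift_v, Matrix.mul_apply]

theorem counitHom_u (i j : Fin n) : counitHom F (uMat F i j) = if i = j then 1 else 0 := by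
  simp [counitHom, lift_u, Matrix.one_apply]

theorem counitHom_v (i j : Fin n) : counitHom F (vMat F i j) = if i = j then 1 else 0 := by
  simp [counitHom, lift_v, Matrix.one_apply]

/-- The bialgebra structure of `H(F)`. -/
instance instBialgebra (F : GL (Fin n) k) : Bialgebra k (H F) :=
  Bialgebra.ofAlgHom (comulHom F) (counitHom F)
    (by
      refine hom_ext (fun i j => ?_) (fun i j => ?_)
      · simp only [AlgHom.comp_apply, comulHom_u, map_sum, Algebra.TensorProduct.map_tmul,
          AlgHom.coe_id, id_eq, TensorProduct.sum_tmul, TensorProduct.tmul_sum]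
        rw [Finset.sum_comm]
        rfl
      · simp only [AlgHom.comp_apply, comulHom_v, map_sum, Algebra.TensorProduct.map_tmul,
          AlgHom.coe_id, id_eq, TensorProduct.sum_tmul, TensorProduct.tmul_sum]
        rw [Finset.sum_comm]
        rfl)
    (by
      refine hom_ext (fun i j => ?_) (fun i j => ?_)
      · simp [comulHom_u, counitHom_u, TensorProduct.ite_tmul]
      · simp [comulHom_v, counitHom_v, TensorProduct.ite_tmul])
    (by
      refine hom_ext (fun i j => ?_) (fun i j => ?_)
      · simp [comulHom_u, counitHom_u, TensorProduct.tmul_ite]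
      · simp [comulHom_v, counitHom_v, TensorProduct.tmul_ite])

theorem comul_u (i j : Fin n) :
    Coalgebra.comul (R := k) (uMat F i j) = ∑ l, uMat F i l ⊗ₜ[k] uMat F l j := comulHom_u i j

theorem comul_v (i j : Fin n) :
    Coalgebra.comul (R := k) (vMat F i j) = ∑ l, vMat F i l ⊗ₜ[k] vMat F l j := comulHom_v i j

theorem counit_u (i j : Fin n) :
    Coalgebra.counit (R := k) (uMat F i j) = if i = j then 1 else 0 := counitHom_u i j

theorem counit_v (i j : Fin n) :
    Coalgebra.counit (R := k) (vMat F i j) = if i = j then 1 else 0 := counitHom_v i j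

/-! ### The antipode -/

/-- The matrix `F ᵗu F⁻¹`. -/
def sV (F : GL (Fin n) k) : Matrix (Fin n) (Fin n) (H F) :=
  scal (H F) F.val * (uMat F)ᵀ * scal (H F) (F⁻¹).val

theorem op_mul_apply {A : Type*} [Ring A] (x y : Matrix (Fin n) (Fin n) A) (i j : Fin n) :
    (x.map MulOpposite.op * y.map MulOpposite.op) i j = MulOpposite.op ((yᵀ * xᵀ) j i) := by
  simp [Matrix.mul_apply]

theorem map_op_mul {A : Type*} [Ring A] (x y : Matrix (Fin n) (Fin n) A) :
    x.map MulOpposite.op * y.map MulOpposite.op = ((yᵀ * xᵀ)ᵀ).map MulOpposite.op := by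
  ext i j : 2
  rw [op_mul_apply]; rfl

theorem scal_op {A : Type*} [Ring A] [Algebra k A] (M : Matrix (Fin n) (Fin n) k) :
    scal Aᵐᵒᵖ M = (scal A M).map MulOpposite.op := by
  ext i j; rfl

theorem transpose_scal_mul {A : Type*} [Ring A] [Algebra k A] (M : Matrix (Fin n) (Fin n) k)
    (x : Matrix (Fin n) (Fin n) A) : (scal A M * x)ᵀ = xᵀ * (scal A M)ᵀ :=
  transpose_mul_of_commute _ _ fun _ _ _ _ => Algebra.commutes _ _

theorem transpose_mul_scal {A : Type*} [Ring A] [Algebra k A] (M : Matrix (Fin n) (Fin n) k)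
    (x : Matrix (Fin n) (Fin n) A) : (x * scal A M)ᵀ = (scal A M)ᵀ * xᵀ :=
  transpose_mul_of_commute _ _ fun _ _ _ _ => (Algebra.commutes _ _).symm

theorem scal_mul_op {A : Type*} [Ring A] [Algebra k A] (M : Matrix (Fin n) (Fin n) k)
    (x : Matrix (Fin n) (Fin n) A) :
    scal Aᵐᵒᵖ M * x.map MulOpposite.op = (scal A M * x).map MulOpposite.op := by
  rw [scal_op, map_op_mul, ← transpose_scal_mul, Matrix.transpose_transpose]

theorem op_mul_scal {A : Type*} [Ring A] [Algebra k A] (M : Matrix (Fin n) (Fin n) k)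
    (x : Matrix (Fin n) (Fin n) A) :
    x.map MulOpposite.op * scal Aᵐᵒᵖ M = (x * scal A M).map MulOpposite.op := by
  rw [scal_op, map_op_mul, ← transpose_mul_scal, Matrix.transpose_transpose]

theorem relations_antipode (F : GL (Fin n) k) :
    Relations F ((vMat F)ᵀ.map MulOpposite.op) ((sV F).map MulOpposite.op) := by
  have h := relations_uv F
  have hone : ((1 : Matrix (Fin n) (Fin n) (H F))).map MulOpposite.op = 1 :=
    Matrix.map_one _ rfl rfl
  have h1 : (scal (H F) F.val)ᵀ * (scal (H F) (F⁻¹).val)ᵀ = 1 := by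
    rw [← transpose_mul_scal, scal_inv_mul_scal, Matrix.transpose_one]
  have h2 : (scal (H F) (F⁻¹).val)ᵀ * (scal (H F) F.val)ᵀ = 1 := by
    rw [← transpose_mul_scal, scal_mul_scal_inv, Matrix.transpose_one]
  have hs : (sV F)ᵀ = (scal (H F) (F⁻¹).val)ᵀ * (uMat F * (scal (H F) F.val)ᵀ) := by
    rw [sV, transpose_mul_scal, transpose_scal_mul, Matrix.transpose_transpose]
  have hv : (scal (H F) F.val * vMat F * scal (H F) (F⁻¹).val)ᵀ =
      (scal (H F) (F⁻¹).val)ᵀ * ((vMat F)ᵀ * (scal (H F) F.val)ᵀ) := by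
    rw [transpose_mul_scal, transpose_scal_mul]
  refine ⟨?_, ?_, ?_, ?_⟩
  · rw [← Matrix.transpose_map, map_op_mul]
    simp only [Matrix.transpose_transpose]
    rw [sV, h.FuF_v, Matrix.transpose_one, hone]
  · rw [← Matrix.transpose_map, map_op_mul]
    simp only [Matrix.transpose_transpose]
    rw [sV, h.v_FuF, Matrix.transpose_one, hone]
  · rw [← Matrix.transpose_map, Matrix.transpose_transpose, scal_mul_op, op_mul_scal, map_op_mul,
      hs, hv]
    have : ∀ A B C D : Matrix (Fin n) (Fin n) (H F),
        A * (B * C) * (A * (D * C)) = A * (B * ((C * A) * D)) * C := by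
      intros; simp only [mul_assoc]
    rw [this, h1, one_mul, h.vt_u, mul_one, h2, Matrix.transpose_one, hone]
  · rw [← Matrix.transpose_map, Matrix.transpose_transpose, scal_mul_op, op_mul_scal, map_op_mul,
      hs, hv]
    have : ∀ A B C D : Matrix (Fin n) (Fin n) (H F),
        A * (B * C) * (A * (D * C)) = A * (B * ((C * A) * D)) * C := by
      intros; simp only [mul_assoc]
    rw [this, h1, one_mul, h.u_vt, mul_one, h2, Matrix.transpose_one, hone]

/-- The antipode as an algebra morphism to the opposite algebra. -/
def antipodeHom (F : GL (Fin n) k) : H F →ₐ[k] (H F)ᵐᵒᵖ := lift (relations_antipode F)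

/-- The antipode, the antimultiplicative map with `S(u) = ᵗv` and `S(v) = F ᵗu F⁻¹`. -/
def antipodeLin (F : GL (Fin n) k) : H F →ₗ[k] H F :=
  (MulOpposite.opLinearEquiv k).symm.toLinearMap ∘ₗ (antipodeHom F).toLinearMap

theorem antipodeLin_u (i j : Fin n) : antipodeLin F (uMat F i j) = vMat F j i := by
  simp [antipodeLin, antipodeHom, lift_u]

theorem antipodeLin_v (i j : Fin n) : antipodeLin F (vMat F i j) = sV F i j := by
  simp [antipodeLin, antipodeHom, lift_v]

theorem antipodeLin_mul (a b : H F) :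
    antipodeLin F (a * b) = antipodeLin F b * antipodeLin F a := by
  simp [antipodeLin]

theorem antipodeLin_algebraMap (r : k) :
    antipodeLin F (algebraMap k (H F) r) = algebraMap k (H F) r := by
  simp [antipodeLin]

theorem antipodeLin_one : antipodeLin F (1 : H F) = 1 := by
  simp [antipodeLin]

theorem antipode_left_aux (S : H F →ₗ[k] H F) (hS : ∀ a b, S (a * b) = S b * S a)
    (t s : H F ⊗[k] H F) (r : k)
    (ht : LinearMap.mul' k (H F) (S.rTensor (H F) t) = algebraMap k (H F) r) :
    LinearMap.mul' k (H F) (S.rTensor (H F) (t * s)) =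
      r • LinearMap.mul' k (H F) (S.rTensor (H F) s) := by
  induction s with
  | zero => simp
  | add a b ha hb => simp only [mul_add, map_add, ha, hb, smul_add]
  | tmul c d =>
    have : ∀ t : H F ⊗[k] H F, LinearMap.mul' k (H F) (S.rTensor (H F) (t * (c ⊗ₜ d))) =
        S c * LinearMap.mul' k (H F) (S.rTensor (H F) t) * d := by
      intro t
      induction t with
      | zero => simp
      | add a b ha hb => simp only [add_mul, mul_add, map_add, ha, hb]
      | tmul a b => simp [hS, mul_assoc]
    rw [this, ht, ← Algebra.commutes, mul_assoc, ← Algebra.smul_def]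
    simp

theorem antipode_right_aux (S : H F →ₗ[k] H F) (hS : ∀ a b, S (a * b) = S b * S a)
    (t s : H F ⊗[k] H F) (r : k)
    (hs : LinearMap.mul' k (H F) (S.lTensor (H F) s) = algebraMap k (H F) r) :
    LinearMap.mul' k (H F) (S.lTensor (H F) (t * s)) =
      r • LinearMap.mul' k (H F) (S.lTensor (H F) t) := by
  induction t with
  | zero => simp
  | add a b ha hb => simp only [add_mul, map_add, ha, hb, smul_add]
  | tmul c d =>
    have : ∀ s : H F ⊗[k] H F, LinearMap.mul' k (H F) (S.lTensor (H F) ((c ⊗ₜ d) * s)) =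
        c * LinearMap.mul' k (H F) (S.lTensor (H F) s) * S d := by
      intro s
      induction s with
      | zero => simp
      | add a b ha hb => simp only [add_mul, mul_add, map_add, ha, hb]
      | tmul a b => simp [hS, mul_assoc]
    rw [this, hs, ← Algebra.commutes, mul_assoc, ← Algebra.smul_def]
    simp

theorem antipode_left (a : H F) :
    LinearMap.mul' k (H F) ((antipodeLin F).rTensor (H F) (comulHom F a)) =
      algebraMap k (H F) (counitHom F a) := by
  have h := relations_uv F
  induction a using induction_on with
  | hs r => simp [Algebra.TensorProduct.algebraMap_apply, antipodeLin_algebraMap]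
  | hu i j =>
    have := congrFun (congrFun h.vt_u i) j
    simp only [Matrix.mul_apply, Matrix.transpose_apply] at this
    simp [comulHom_u, counitHom_u, antipodeLin_u, this, Matrix.one_apply, apply_ite (algebraMap k (H F))]
  | hv i j =>
    have := congrFun (congrFun h.FuF_v i) j
    rw [Matrix.mul_apply] at this
    simp only [comulHom_v, counitHom_v, map_sum, LinearMap.rTensor_tmul, antipodeLin_v,
      LinearMap.mul'_apply]
    exact this.trans (by simp [Matrix.one_apply, apply_ite (algebraMap k (H F))])
  | hadd a b ha hb => simp only [map_add, ha, hb]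
  | hmul a b ha hb =>
    rw [map_mul, antipode_left_aux _ antipodeLin_mul _ _ _ ha, hb, map_mul, map_mul,
      Algebra.smul_def]

theorem antipode_right (a : H F) :
    LinearMap.mul' k (H F) ((antipodeLin F).lTensor (H F) (comulHom F a)) =
      algebraMap k (H F) (counitHom F a) := by
  have h := relations_uv F
  induction a using induction_on with
  | hs r => simp [Algebra.TensorProduct.algebraMap_apply, antipodeLin_one]
  | hu i j =>
    have := congrFun (congrFun h.u_vt i) j
    simp only [Matrix.mul_apply, Matrix.transpose_apply] at this
    simp [comulHom_u, counitHom_u, antipodeLin_u, this, Matrix.one_apply, apply_ite (algebraMap k (H F))]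
  | hv i j =>
    have := congrFun (congrFun h.v_FuF i) j
    rw [Matrix.mul_apply] at this
    simp only [comulHom_v, counitHom_v, map_sum, LinearMap.lTensor_tmul, antipodeLin_v,
      LinearMap.mul'_apply]
    exact this.trans (by simp [Matrix.one_apply, apply_ite (algebraMap k (H F))])
  | hadd a b ha hb => simp only [map_add, ha, hb]
  | hmul a b ha hb =>
    rw [map_mul, antipode_right_aux _ antipodeLin_mul _ _ _ hb, ha, map_mul, map_mul,
      Algebra.smul_def, ← Algebra.commutes]

/-- The Hopf algebra structure of `H(F)`. -/
instance instHopfAlgebra (F : GL (Fin n) k) : HopfAlgebra k (H F) where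
  antipode := antipodeLin F
  mul_antipode_rTensor_comul := LinearMap.ext antipode_left
  mul_antipode_lTensor_comul := LinearMap.ext antipode_right

theorem antipode_u (i j : Fin n) : HopfAlgebra.antipode k (uMat F i j) = vMat F j i :=
  antipodeLin_u i j

theorem antipode_v (i j : Fin n) : HopfAlgebra.antipode k (vMat F i j) =
    (scal (H F) F.val * (uMat F)ᵀ * scal (H F) (F⁻¹).val) i j :=
  antipodeLin_v i j

end Algebra

/-! ### Normalizable matrices -/

/-- `F` is normalizable over `k`: `tr (c F) = tr ((c F)⁻¹)` for some nonzero `c` in `k`. -/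
def IsNormalizable {k : Type u} [Field k] {n : ℕ} (F : GL (Fin n) k) : Prop :=
  ∃ c : k, c ≠ 0 ∧ (c • F.val).trace = ((c • F.val)⁻¹).trace

/-! ### Cosemisimple coalgebras -/

section Coalgebra

variable (k : Type u) {C : Type v} [Field k] [AddCommGroup C] [Module k C] [Coalgebra k C]

/-- `D` is a subcoalgebra of `C`: `Δ(D) ⊆ D ⊗ D`. -/
def IsSubcoalgebra (D : Submodule k C) : Prop :=
  D.map (Coalgebra.comul (R := k) (A := C)) ≤
    LinearMap.range (TensorProduct.map D.subtype D.subtype)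

/-- `D` is a simple subcoalgebra of `C`: it is a nonzero subcoalgebra whose only subcoalgebras
are `0` and `D`. -/
def IsSimpleSubcoalgebra (D : Submodule k C) : Prop :=
  IsSubcoalgebra k D ∧ D ≠ ⊥ ∧ ∀ E : Submodule k C, IsSubcoalgebra k E → E ≤ D → E = ⊥ ∨ E = D

variable (C) in
/-- `C` is cosemisimple: it is the direct sum of a family of simple subcoalgebras. -/
def IsCosemisimple : Prop :=
  ∃ S : Set (Submodule k C), (∀ D ∈ S, IsSimpleSubcoalgebra k D) ∧
    DirectSum.IsInternal (fun D : S => (D : Submodule k C))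

end Coalgebra

end Cosovereign

end

/-!
Let `M = ᵗF`, so that `S²(u) = M⁻¹ u M` on the generators. Over the algebraically closed field `K`
the equation `tr (c F) = tr ((c F)⁻¹)` reads `c² tr F = tr F⁻¹`; hence `F` is normalizable over `K`
as soon as `tr F` and `tr F⁻¹` are both zero or both nonzero
(`isNormalizable_of_trace_eq_zero`, `isNormalizable_of_trace_ne_zero`). If `H(F)` is cosemisimple
and `F` is not normalizable, both traces turn out to be nonzero, which is a contradiction.

*Orthogonality.* A cosemisimple Hopf algebra has a two-sided invariant functional `φ` with
`φ 1 = 1`: the line `k 1` is one of the simple summands, and `φ` is the projection onto it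
(`exists_haar_functional`). By invariance the matrices `Y = (φ(v i a * u m b))` and
`X = (φ(u a j * v b l))`, indexed by `a, b`, commute with `u`, while the defining relations give
`tr (ᵗF Y) = F i m` and `tr (ᵗF⁻¹ X) = F⁻¹ j l`. If commuting with `u` forced `X` and `Y` to be
scalar, then `tr F = 0` would give `F = 0`, and `tr F⁻¹ = 0` would give `F⁻¹ = 0`.

*Matrices commuting with `u`.* They are scalar up to a part that the traces above do not see, and
this is read off from one explicit representation of `H(F)`. If `M` has a single eigenvalue `c`,
then `tr F = n c` and `tr F⁻¹ = n c⁻¹` vanish together, so `F` is normalizable. Otherwise there is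
an idempotent `p ≠ 0, 1` over `K` commuting with `M`. For `g` invertible and a matrix `b = p b (1 - p)`
with `g b g⁻¹ = M⁻¹ b M`, the block triangular matrix `g⁻¹ p + (1 - p) + b` satisfies the defining
relations (`relations_of_block`). Taking for `g` the conjugation by `M` on `K × Mₙ(K)` and for `b`
the matrix of coordinate functionals of `N ↦ p N (1 - p)`, one finds that a matrix `X` commuting with
`u` commutes with every `p N (1 - p)` (`mul_corner_of_commute`). Then `X p = c p` and
`(1 - p) X = c (1 - p)` for one scalar `c`, so `tr (M' X) = c tr M'` for every `M'` commuting with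
`p`, in particular for `ᵗF` and `ᵗF⁻¹` (`trace_mul_of_mul_corner`).
-/

open scoped TensorProduct Matrix

noncomputable section

namespace Cosovereign

/-! ### Inverses of block triangular elements -/

section Block
variable {R : Type*} [Ring R] {d d' p b : R}

/-- With `b = p b (1 - p)` and `d` commuting with the idempotent `p`, the block triangular element
`d⁻¹ p + (1 - p) + b` has inverse `d p + (1 - p) - d b`. -/
theorem block_mul_inv (hd' : d' * d = 1) (hp : p * p = p) (hdp : d * p = p * d)
    (hpb : p * b = b) (hbp : b * p = 0) :
    (d' * p + (1 - p) + b) * (d * p + (1 - p) - d * b) = 1 := by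
  have hbd : b * d * p = 0 := by rw [mul_assoc, hdp, ← mul_assoc, hbp, zero_mul]
  have h1 : d' * p * d = p := by rw [mul_assoc, ← hdp, ← mul_assoc, hd', one_mul]
  have h2 : p * d * p = d * p := by rw [← hdp, mul_assoc, hp]
  have h3 : p * d * b = d * b := by rw [← hdp, mul_assoc, hpb]
  have h4 : b * d * b = 0 := by rw [← hpb, ← mul_assoc, hpb, hbd, zero_mul]
  linear_combination (norm := noncomm_ring)
    h1 * p - h1 * b - hpb + hp - h2 + h3 + hbd - h4 - hbp - d' * hp + hp

theorem block_inv_mul (hd : d * d' = 1) (hd' : d' * d = 1) (hp : p * p = p)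
    (hdp : d * p = p * d) (hpb : p * b = b) (hbp : b * p = 0) :
    (d * p + (1 - p) - d * b) * (d' * p + (1 - p) + b) = 1 := by
  have h1 : d * p * d' = p := by rw [hdp, mul_assoc, hd, mul_one]
  have hdp' : p * d' = d' * p := by
    rw [← one_mul (p * d'), ← hd', mul_assoc d', ← mul_assoc d, h1]
  have h2 : p * d' * p = d' * p := by rw [hdp', mul_assoc, hp]
  have h3 : b * d' * p = 0 := by rw [mul_assoc, ← hdp', ← mul_assoc, hbp, zero_mul]
  have h4 : b * b = 0 := by
    nth_rewrite 2 [← hpb]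
    rw [← mul_assoc, hbp, zero_mul]
  linear_combination (norm := noncomm_ring)
    h1 * p + hp - h2 + d * hpb - hpb - d * hp + hp - d * h3 + d * hbp - d * h4

/-- The lower triangular version, `b = (1 - p) b p`, with `d b d⁻¹` in place of `b` in the first
matrix: these are the relations between `v` and `F ᵗu F⁻¹`. -/
theorem block_mul_inv_conj (hd : d * d' = 1) (hd' : d' * d = 1) (hp : p * p = p)
    (hdp : d * p = p * d) (hpb : p * b = 0) (hbp : b * p = b) :
    (d * p + (1 - p) - d * b) * (d' * p + (1 - p) + d * b * d') = 1 := by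
  have h1 : d * p * d' = p := by rw [hdp, mul_assoc, hd, mul_one]
  have hdp' : p * d' = d' * p := by
    rw [← one_mul (p * d'), ← hd', mul_assoc d', ← mul_assoc d, h1]
  have h2 : p * d * b = 0 := by rw [← hdp, mul_assoc, hpb, mul_zero]
  have h3 : p * d' * p = d' * p := by rw [hdp', mul_assoc, hp]
  have h4 : b * d' * p = b * d' := by rw [mul_assoc, ← hdp', ← mul_assoc, hbp]
  have h5 : b * d * b = 0 := by
    nth_rewrite 1 [← hbp]
    rw [mul_assoc b p d, mul_assoc, h2, mul_zero]
  linear_combination (norm := noncomm_ring)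
    h1 * p + hp + d * h2 * d' - h3 - h2 * d' - d * h4 + d * hbp - d * h5 * d' - d * hp + hp

theorem block_inv_mul_conj (hd : d * d' = 1) (hd' : d' * d = 1) (hp : p * p = p)
    (hdp : d * p = p * d) (hpb : p * b = 0) (hbp : b * p = b) :
    (d' * p + (1 - p) + d * b * d') * (d * p + (1 - p) - d * b) = 1 := by
  have h1 : d' * p * d = p := by rw [mul_assoc, ← hdp, ← mul_assoc, hd', one_mul]
  have h0 : d * p * d' = p := by rw [hdp, mul_assoc, hd, mul_one]
  have hdp' : p * d' = d' * p := by
    rw [← one_mul (p * d'), ← hd', mul_assoc d', ← mul_assoc d, h0]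
  have h2 : p * d * b = 0 := by rw [← hdp, mul_assoc, hpb, mul_zero]
  have h3 : p * d * p = d * p := by rw [← hdp, mul_assoc, hp]
  have h4 : b * d' * p = b * d' := by rw [mul_assoc, ← hdp', ← mul_assoc, hbp]
  have h5 : b * b = 0 := by
    nth_rewrite 1 [← hbp]
    rw [mul_assoc, hpb, mul_zero]
  linear_combination (norm := noncomm_ring)
    h1 * p + hp - d' * h2 - h3 + h2 - d' * hp + hp + d * b * hd' * p - d * b * hd' * b
      - d * h4 + d * hbp - d * h5

end Block

/-! ### Normalizable matrices and idempotents -/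

section Trace
variable {K : Type*} [Field K] {n : ℕ}

theorem isNormalizable_of_trace_ne_zero [IsAlgClosed K] (F : GL (Fin n) K)
    (h : F.val.trace ≠ 0) (h' : (F⁻¹).val.trace ≠ 0) : IsNormalizable F := by
  obtain ⟨c, hc⟩ := IsAlgClosed.exists_pow_nat_eq ((F⁻¹).val.trace / F.val.trace) two_pos
  have hc0 : c ≠ 0 := by
    rintro rfl
    rw [zero_pow two_ne_zero] at hc
    exact div_ne_zero h' h hc.symm
  refine ⟨c, hc0, ?_⟩
  have e : (c • F.val)⁻¹ = c⁻¹ • (F⁻¹).val := by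
    refine Matrix.inv_eq_right_inv ?_
    rw [smul_mul_smul_comm, mul_inv_cancel₀ hc0, ← Units.val_mul, mul_inv_cancel, Units.val_one,
      one_smul]
  rw [e, Matrix.trace_smul, Matrix.trace_smul, smul_eq_mul, smul_eq_mul]
  field_simp at hc ⊢
  exact hc

theorem isNormalizable_of_trace_eq_zero (F : GL (Fin n) K)
    (h : F.val.trace = 0) (h' : (F⁻¹).val.trace = 0) : IsNormalizable F := by
  refine ⟨1, one_ne_zero, ?_⟩
  rw [one_smul, h, ← Matrix.coe_units_inv, h']

/-- If `M` has two eigenvalues, the spectral projection onto the generalized eigenspace of one of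
them, a polynomial in `M`, is a nontrivial idempotent commuting with `M`; otherwise `M - c` is
nilpotent for the only eigenvalue `c`. -/
theorem exists_idempotent_or_isNilpotent [IsAlgClosed K] [NeZero n]
    (M : Matrix (Fin n) (Fin n) K) :
    (∃ p, p * p = p ∧ Commute p M ∧ p ≠ 0 ∧ p ≠ 1) ∨
      ∃ c : K, IsNilpotent (M - algebraMap K _ c) := by
  obtain ⟨c, hc⟩ := IsAlgClosed.exists_root M.charpoly (by
    rw [Matrix.charpoly_degree_eq_dim]; simpa using NeZero.ne n)
  obtain ⟨r, hr, hdvd⟩ := Polynomial.exists_eq_pow_rootMultiplicity_mul_and_not_dvd M.charpoly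
    M.charpoly_monic.ne_zero c
  set m := M.charpoly.rootMultiplicity c
  have hcop : IsCoprime ((Polynomial.X - Polynomial.C c) ^ m) r :=
    IsCoprime.pow_left ((Polynomial.irreducible_X_sub_C c).coprime_iff_not_dvd.2 hdvd)
  have hm : m ≠ 0 := by
    rw [← Nat.pos_iff_ne_zero, Polynomial.rootMultiplicity_pos M.charpoly_monic.ne_zero]
    exact hc
  obtain ⟨s, t, hst⟩ := hcop
  have hM : Polynomial.aeval M (Polynomial.X - Polynomial.C c) = M - algebraMap K _ c := by simp
  have hzero : (M - algebraMap K _ c) ^ m * Polynomial.aeval M r = 0 := by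
    rw [← hM, ← map_pow, ← map_mul, ← hr, Matrix.aeval_self_charpoly]
  have hone :
      Polynomial.aeval M s * (M - algebraMap K _ c) ^ m + Polynomial.aeval M (t * r) = 1 := by
    rw [← hM, ← map_pow, ← map_mul, ← map_add, hst, map_one]
  -- The projection onto the generalized eigenspace of `c` is `(t * r)(M)`.
  by_cases h1 : Polynomial.aeval M (t * r) = 1
  · right
    refine ⟨c, m, ?_⟩
    calc _ = (M - algebraMap K _ c) ^ m * Polynomial.aeval M (t * r) := by rw [h1, mul_one]
      _ = 0 := by rw [mul_comm t r, map_mul, ← mul_assoc, hzero, zero_mul]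
  by_cases h0 : Polynomial.aeval M (t * r) = 0
  · exfalso
    rw [h0, add_zero] at hone
    have hu : IsUnit ((M - algebraMap K _ c) ^ m) := by
      rw [Matrix.isUnit_iff_isUnit_det]
      exact Matrix.isUnit_det_of_left_inverse hone
    rw [isUnit_pow_iff hm, Matrix.isUnit_iff_isUnit_det, isUnit_iff_ne_zero] at hu
    apply hu
    rw [Polynomial.IsRoot, Matrix.eval_charpoly] at hc
    rw [← neg_sub, Matrix.det_neg, Matrix.algebraMap_eq_diagonal]
    erw [hc]
    simp
  · left
    refine ⟨_, ?_, ?_, h0, h1⟩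
    · rw [← map_mul]
      have : t * r * (t * r) = t * r - s * t * M.charpoly := by
        rw [hr]; linear_combination (t * r) * hst
      rw [this, map_sub, map_mul _ (s * t), Matrix.aeval_self_charpoly, mul_zero, sub_zero]
    · simpa using (Commute.all (t * r) Polynomial.X).map (Polynomial.aeval M)

end Trace

/-! ### The Haar functional of a cosemisimple bialgebra -/

section Haar
variable {k : Type*} {C : Type*} [Field k] [Ring C] [Bialgebra k C]

theorem map_comul_eq_zero {M N : Type*} [AddCommGroup M] [Module k M] [AddCommGroup N] [Module k N]
    {D : Submodule k C} (hD : IsSubcoalgebra k D) (f : C →ₗ[k] M) (g : C →ₗ[k] N)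
    (h : (∀ a ∈ D, f a = 0) ∨ ∀ a ∈ D, g a = 0) {a : C} (ha : a ∈ D) :
    TensorProduct.map f g (Coalgebra.comul (R := k) a) = 0 := by
  obtain ⟨t, ht⟩ := hD (Submodule.mem_map_of_mem ha)
  rw [← ht, ← LinearMap.comp_apply, ← TensorProduct.map_comp]
  rcases h with h | h
  · rw [show f ∘ₗ D.subtype = 0 from LinearMap.ext fun x => h x x.2, TensorProduct.map_zero_left,
      LinearMap.zero_apply]
  · rw [show g ∘ₗ D.subtype = 0 from LinearMap.ext fun x => h x x.2, TensorProduct.map_zero_right,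
      LinearMap.zero_apply]

theorem isSubcoalgebra_span_one : IsSubcoalgebra k (Submodule.span k {(1 : C)}) := by
  rw [IsSubcoalgebra, Submodule.map_span, Submodule.span_le, Set.image_singleton,
    Set.singleton_subset_iff, Bialgebra.comul_one]
  have h1 : (1 : C) ∈ Submodule.span k {(1 : C)} := Submodule.mem_span_singleton_self 1
  exact ⟨⟨1, h1⟩ ⊗ₜ ⟨1, h1⟩, rfl⟩

/-- A cosemisimple bialgebra has a normalized two-sided invariant functional (a Haar functional). -/
theorem exists_haar_functional (h : IsCosemisimple k C) :
    ∃ φ : C →ₗ[k] k, φ 1 = 1 ∧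
      (∀ a, TensorProduct.rid k C (φ.lTensor C (Coalgebra.comul a)) = algebraMap k C (φ a)) ∧
      ∀ a, TensorProduct.lid k C (φ.rTensor C (Coalgebra.comul a)) = algebraMap k C (φ a) := by
  classical
  obtain ⟨S, hS, hint⟩ := h
  let A : S → Submodule k C := fun D => D
  let e : (DirectSum S fun D => A D) ≃ₗ[k] C :=
    LinearEquiv.ofBijective (DirectSum.coeLinearMap A) hint
  let π : S → C →ₗ[k] C := fun i =>
    (A i).subtype ∘ₗ DirectSum.component k S (fun D => A D) i ∘ₗ e.symm.toLinearMap
  have hπ : ∀ i j : S, i ≠ j → ∀ a ∈ A i, π j a = 0 := by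
    intro i j hij a ha
    have := hint.ofBijective_coeLinearMap_of_mem_ne hij ha
    simp only [π, LinearMap.comp_apply]
    exact congrArg Subtype.val this
  have hπ' : ∀ i, ∀ a ∈ A i, π i a = a := by
    intro i a ha
    have := hint.ofBijective_coeLinearMap_of_mem ha
    exact congrArg Subtype.val this
  have hind : ∀ {P : C → Prop}, (∀ i, ∀ a ∈ A i, P a) → P 0 → (∀ a b, P a → P b → P (a + b)) →
      ∀ a, P a := by
    intro P h1 h2 h3 a
    have ha : a ∈ iSup A := by rw [hint.submodule_iSup_eq_top]; trivial
    exact Submodule.iSup_induction A (motive := P) ha h1 h2 h3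
  have hone : (1 : C) ≠ 0 := fun h0 => by
    have := congrArg (Coalgebra.counit (R := k)) h0
    simp at this
  -- Applied to `Δ(1) = 1 ⊗ 1`, this shows that `1` has only one nonzero component.
  have hcross : ∀ i j, i ≠ j → ∀ a,
      TensorProduct.map (π i) (π j) (Coalgebra.comul (R := k) a) = 0 := by
    intro i j hij
    refine hind (fun l a ha => ?_) (by simp) (fun a b ha hb => by simp [ha, hb])
    refine map_comul_eq_zero (hS l l.2).1 _ _ ?_ ha
    rcases eq_or_ne l i with rfl | hl
    · exact Or.inr (hπ l j hij)
    · exact Or.inl (hπ l i hl)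
  obtain ⟨i, hi⟩ : ∃ i, π i 1 ≠ 0 := by
    by_contra! hcon
    have h0 : e.symm 1 = 0 := by
      ext j
      exact hcon j
    exact hone (by simpa using h0)
  have hmem : (1 : C) ∈ A i := by
    have h1 : e.symm 1 = DirectSum.lof k S (fun D => A D) i ((e.symm 1) i) := by
      ext j
      rcases eq_or_ne i j with rfl | hij
      · simp [DirectSum.lof_eq_of]
      · have h2 := hcross i j hij 1
        rw [Bialgebra.comul_one, Algebra.TensorProduct.one_def, TensorProduct.map_tmul] at h2
        rw [DirectSum.lof_eq_of, DirectSum.of_eq_of_ne _ _ _ hij.symm]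
        obtain ⟨f, hf⟩ := not_forall.1 (mt (Module.forall_dual_apply_eq_zero_iff k (π i 1)).1 hi)
        have h3 := congrArg (fun t => TensorProduct.lid k C (f.rTensor C t)) h2
        simp only [LinearMap.rTensor_tmul, TensorProduct.lid_tmul, map_zero] at h3
        exact (smul_eq_zero.1 h3).resolve_left hf
    have h2 : (1 : C) = ((e.symm 1) i : A i) := by
      conv_lhs => rw [← e.apply_symm_apply 1, h1]
      exact DirectSum.coeLinearMap_lof A i _
    rw [h2]
    exact Subtype.property _
  have hspan : A i = Submodule.span k {1} := by
    refine (((hS i i.2).2.2 _ isSubcoalgebra_span_one ?_).resolve_left ?_).symm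
    · exact (Submodule.span_singleton_le_iff_mem _ _).2 hmem
    · simpa using hone
  let φ : C →ₗ[k] k := Coalgebra.counit ∘ₗ π i
  have hφ : φ 1 = 1 := by simp [φ, hπ' i 1 hmem]
  have hφ0 : ∀ j, j ≠ i → ∀ a ∈ A j, φ a = 0 := fun j hj a ha => by simp [φ, hπ j i hj a ha]
  refine ⟨φ, hφ, hind (fun j a ha => ?_) (by simp) (fun a b ha hb => by simp only [map_add, ha, hb]),
    hind (fun j a ha => ?_) (by simp) (fun a b ha hb => by simp only [map_add, ha, hb])⟩
  all_goals rcases eq_or_ne j i with rfl | hj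
  · rw [hspan] at ha
    obtain ⟨c, rfl⟩ := Submodule.mem_span_singleton.1 ha
    simp [map_smul, hφ, Algebra.TensorProduct.one_def, Algebra.algebraMap_eq_smul_one]
  · rw [hφ0 j hj a ha, map_zero]
    exact (congrArg _ (map_comul_eq_zero (hS j j.2).1 LinearMap.id φ (Or.inr (hφ0 j hj)) ha)).trans
      (map_zero _)
  · rw [hspan] at ha
    obtain ⟨c, rfl⟩ := Submodule.mem_span_singleton.1 ha
    simp [map_smul, hφ, Algebra.TensorProduct.one_def, Algebra.algebraMap_eq_smul_one]
  · rw [hφ0 j hj a ha, map_zero]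
    exact (congrArg _ (map_comul_eq_zero (hS j j.2).1 φ LinearMap.id (Or.inl (hφ0 j hj)) ha)).trans
      (map_zero _)

end Haar

/-! ### Orthogonality relations in `H(F)` -/

section Orthogonality
variable {k : Type*} [Field k] {n : ℕ} {F : GL (Fin n) k}

/-- Right invariance of `φ` says that `u X ᵗv = X`. -/
theorem commute_of_right_invariant (φ : H F →ₗ[k] k)
    (hφ : ∀ a, TensorProduct.rid k (H F) (φ.lTensor (H F) (Coalgebra.comul a)) =
      algebraMap k (H F) (φ a)) (j l : Fin n) :
    Commute (scal (H F) (Matrix.of fun a b => φ (uMat F a j * vMat F b l))) (uMat F) := by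
  set X := scal (H F) (Matrix.of fun a b => φ (uMat F a j * vMat F b l))
  have key : uMat F * X * (vMat F)ᵀ = X := by
    ext a b
    refine Eq.trans ?_ (hφ (uMat F a j * vMat F b l))
    rw [Bialgebra.comul_mul, comul_u, comul_v, Finset.sum_mul_sum, Matrix.mul_apply,
      Finset.sum_comm]
    simp only [X, scal, Matrix.mul_apply, Finset.sum_mul, map_sum,
      Algebra.TensorProduct.tmul_mul_tmul, LinearMap.lTensor_tmul, TensorProduct.rid_tmul,
      Matrix.map_apply, Matrix.of_apply, Matrix.transpose_apply]
    refine Finset.sum_congr rfl fun c _ => Finset.sum_congr rfl fun d _ => ?_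
    rw [← Algebra.commutes, mul_assoc, ← Algebra.smul_def]
  calc X * uMat F = uMat F * X * ((vMat F)ᵀ * uMat F) := by rw [← mul_assoc, key]
    _ = uMat F * X := by rw [(relations_uv F).vt_u, mul_one]

/-- Left invariance of `φ` says that `ᵗv Y u = Y`. -/
theorem commute_of_left_invariant (φ : H F →ₗ[k] k)
    (hφ : ∀ a, TensorProduct.lid k (H F) (φ.rTensor (H F) (Coalgebra.comul a)) =
      algebraMap k (H F) (φ a)) (i m : Fin n) :
    Commute (scal (H F) (Matrix.of fun a b => φ (vMat F i a * uMat F m b))) (uMat F) := by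
  set Y := scal (H F) (Matrix.of fun a b => φ (vMat F i a * uMat F m b))
  have key : (vMat F)ᵀ * Y * uMat F = Y := by
    ext a b
    refine Eq.trans ?_ (hφ (vMat F i a * uMat F m b))
    rw [Bialgebra.comul_mul, comul_u, comul_v, Finset.sum_mul_sum, Matrix.mul_apply,
      Finset.sum_comm]
    simp only [Y, scal, Matrix.mul_apply, Finset.sum_mul, map_sum,
      Algebra.TensorProduct.tmul_mul_tmul, LinearMap.rTensor_tmul, TensorProduct.lid_tmul,
      Matrix.map_apply, Matrix.of_apply, Matrix.transpose_apply]
    refine Finset.sum_congr rfl fun c _ => Finset.sum_congr rfl fun d _ => ?_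
    rw [← Algebra.commutes, mul_assoc, ← Algebra.smul_def]
  calc Y * uMat F = uMat F * (vMat F)ᵀ * Y * uMat F := by rw [(relations_uv F).u_vt, one_mul]
    _ = uMat F * Y := by rw [mul_assoc, mul_assoc, ← mul_assoc _ Y, key]

/-- This is `φ` applied to the relation `ᵗu F⁻¹ v = F⁻¹`. -/
theorem trace_transpose_mul_integral_u_v (φ : H F →ₗ[k] k) (hφ : φ 1 = 1) (j l : Fin n) :
    ((F⁻¹).valᵀ * Matrix.of fun a b => φ (uMat F a j * vMat F b l)).trace = (F⁻¹).val j l := by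
  have h := (relations_uv F).FuF_v
  have h' : (uMat F)ᵀ * scal (H F) (F⁻¹).val * vMat F = scal (H F) (F⁻¹).val := by
    calc _ = scal (H F) (F⁻¹).val * scal (H F) F.val *
          ((uMat F)ᵀ * scal (H F) (F⁻¹).val * vMat F) := by rw [scal_inv_mul_scal, one_mul]
      _ = scal (H F) (F⁻¹).val *
          (scal (H F) F.val * (uMat F)ᵀ * scal (H F) (F⁻¹).val * vMat F) := by
        simp only [mul_assoc]
      _ = _ := by rw [h, mul_one]
  have h2 := congrArg φ (congrFun (congrFun h' j) l)
  conv_rhs at h2 =>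
    rw [scal, Matrix.map_apply, Algebra.algebraMap_eq_smul_one, map_smul, hφ, smul_eq_mul, mul_one]
  rw [← h2]
  simp only [Matrix.trace, Matrix.diag, Matrix.mul_apply, Matrix.transpose_apply, Matrix.of_apply,
    Matrix.map_apply, Finset.sum_mul, map_sum]
  refine Finset.sum_congr rfl fun b _ => Finset.sum_congr rfl fun a _ => ?_
  rw [← Algebra.commutes, mul_assoc, ← Algebra.smul_def, map_smul, smul_eq_mul]

/-- This is `φ` applied to the relation `v F ᵗu = F`. -/
theorem trace_transpose_mul_integral_v_u (φ : H F →ₗ[k] k) (hφ : φ 1 = 1) (i m : Fin n) :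
    (F.valᵀ * Matrix.of fun a b => φ (vMat F i a * uMat F m b)).trace = F.val i m := by
  have h := (relations_uv F).v_FuF
  have h' : vMat F * scal (H F) F.val * (uMat F)ᵀ = scal (H F) F.val := by
    calc _ = vMat F * scal (H F) F.val * (uMat F)ᵀ *
          (scal (H F) (F⁻¹).val * scal (H F) F.val) := by rw [scal_inv_mul_scal, mul_one]
      _ = vMat F * (scal (H F) F.val * (uMat F)ᵀ * scal (H F) (F⁻¹).val) * scal (H F) F.val := by
        simp only [mul_assoc]
      _ = _ := by rw [h, one_mul]
  have h2 := congrArg φ (congrFun (congrFun h' i) m)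
  conv_rhs at h2 =>
    rw [scal, Matrix.map_apply, Algebra.algebraMap_eq_smul_one, map_smul, hφ, smul_eq_mul, mul_one]
  rw [← h2]
  simp only [Matrix.trace, Matrix.diag, Matrix.mul_apply, Matrix.transpose_apply, Matrix.of_apply,
    Matrix.map_apply, Finset.sum_mul, map_sum]
  refine Finset.sum_congr rfl fun b _ => Finset.sum_congr rfl fun a _ => ?_
  rw [← Algebra.commutes, mul_assoc, ← Algebra.smul_def, map_smul, smul_eq_mul]

end Orthogonality

/-! ### A block triangular representation of `H(F)` -/

section Representation
variable {K : Type*} [Field K] {n : ℕ}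

theorem diagonal_mul_scal {A : Type*} [Ring A] [Algebra K A] (g : A)
    (M : Matrix (Fin n) (Fin n) K) :
    Matrix.diagonal (fun _ => g) * scal A M = scal A M * Matrix.diagonal (fun _ => g) := by
  ext i j
  simp [Matrix.diagonal_mul, Matrix.mul_diagonal, Algebra.commutes]

theorem transpose_diagonal_mul {A : Type*} [Ring A] (g : A) (x : Matrix (Fin n) (Fin n) A) :
    (Matrix.diagonal (fun _ => g) * x)ᵀ = Matrix.diagonal (fun _ => g) * xᵀ := by
  ext i j
  simp [Matrix.diagonal_mul]

/-- Block triangular solutions of the defining relations. The hypothesis `hb` is the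
transpose of `M⁻¹ b M = g b g⁻¹` with `M = ᵗF`. -/
theorem relations_of_block {A : Type*} [Ring A] [Algebra K A] (F : GL (Fin n) K)
    {p : Matrix (Fin n) (Fin n) K} (hp : p * p = p) (hpF : Commute p F.valᵀ) {g g' : A}
    (hg : g * g' = 1) (hg' : g' * g = 1) {b : Matrix (Fin n) (Fin n) A}
    (hpb : scal A p * b = b) (hbp : b * scal A p = 0)
    (hb : scal A F.val * bᵀ * scal A (F⁻¹).val =
      Matrix.diagonal (fun _ => g) * bᵀ * Matrix.diagonal (fun _ => g')) :
    Relations F (Matrix.diagonal (fun _ => g') * scal A p + (1 - scal A p) + b)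
      (Matrix.diagonal (fun _ => g) * scal A p + (1 - scal A p) -
        Matrix.diagonal (fun _ => g) * b)ᵀ := by
  set d : Matrix (Fin n) (Fin n) A := Matrix.diagonal (fun _ => g)
  set d' : Matrix (Fin n) (Fin n) A := Matrix.diagonal (fun _ => g')
  have hd : d * d' = 1 := by simp [d, d', hg]
  have hd' : d' * d = 1 := by simp [d, d', hg']
  have hpp : scal A p * scal A p = scal A p := by rw [← Matrix.map_mul, hp]
  have hP : scal A pᵀ * scal A pᵀ = scal A pᵀ := by
    rw [← Matrix.map_mul, ← Matrix.transpose_mul, hp]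
  have ht : (scal A p)ᵀ = scal A pᵀ := rfl
  have hpb' : bᵀ * scal A pᵀ = bᵀ := by rw [← ht, ← transpose_scal_mul, hpb]
  have hbp' : scal A pᵀ * bᵀ = 0 := by
    rw [← ht, ← transpose_mul_scal, hbp, Matrix.transpose_zero]
  have hFP : scal A F.val * scal A pᵀ = scal A pᵀ * scal A F.val := by
    rw [← Matrix.map_mul, ← Matrix.map_mul]
    congr 1
    simpa using congrArg Matrix.transpose hpF.eq
  have hv : (d * scal A p + (1 - scal A p) - d * b)ᵀ =
      d * scal A pᵀ + (1 - scal A pᵀ) - d * bᵀ := by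
    simp only [d, Matrix.transpose_add, Matrix.transpose_sub, Matrix.transpose_one,
      transpose_diagonal_mul, ht]
  have hu : scal A F.val * (d' * scal A p + (1 - scal A p) + b)ᵀ * scal A (F⁻¹).val =
      d' * scal A pᵀ + (1 - scal A pᵀ) + d * bᵀ * d' := by
    simp only [d', Matrix.transpose_add, Matrix.transpose_sub, Matrix.transpose_one,
      transpose_diagonal_mul, ht]
    rw [← hb]
    have h1 := scal_mul_scal_inv A F
    have h2 : scal A F.val * d' = d' * scal A F.val := (diagonal_mul_scal _ _).symm
    have h3 : scal A F.val * scal A pᵀ * scal A (F⁻¹).val = scal A pᵀ := by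
      rw [hFP, mul_assoc, h1, mul_one]
    linear_combination (norm := noncomm_ring)
      h2 * scal A pᵀ * scal A (F⁻¹).val + d' * h3 + h1 - h3
  refine ⟨?_, ?_, ?_, ?_⟩
  · rw [Matrix.transpose_transpose]
    exact block_mul_inv hd' hpp (diagonal_mul_scal _ _) hpb hbp
  · rw [Matrix.transpose_transpose]
    exact block_inv_mul hd hd' hpp (diagonal_mul_scal _ _) hpb hbp
  · rw [hv, hu]
    exact block_mul_inv_conj hd hd' hP (diagonal_mul_scal _ _) hbp' hpb'
  · rw [hv, hu]
    exact block_inv_mul_conj hd hd' hP (diagonal_mul_scal _ _) hbp' hpb'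

/-- The endomorphism of `K × Mₙ(K)` that fixes the first factor and conjugates the second by `M`. -/
def conjEnd (M : GL (Fin n) K) : Module.End K (K × Matrix (Fin n) (Fin n) K) :=
  LinearMap.prodMap LinearMap.id
    (LinearMap.mulLeftRight K (M.val, (M⁻¹).val))

theorem conjEnd_apply (M : GL (Fin n) K) (w : K × Matrix (Fin n) (Fin n) K) :
    conjEnd M w = (w.1, M.val * w.2 * (M⁻¹).val) := rfl

theorem conjEnd_mul_inv (M : GL (Fin n) K) : conjEnd M * conjEnd M⁻¹ = 1 := by
  refine LinearMap.ext fun w => ?_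
  rw [Module.End.mul_apply, conjEnd_apply, conjEnd_apply, inv_inv]
  have h : M.val * (M⁻¹).val = 1 := by rw [← Units.val_mul, mul_inv_cancel, Units.val_one]
  have : M.val * ((M⁻¹).val * w.2 * M.val) * (M⁻¹).val = w.2 := by
    calc _ = M.val * (M⁻¹).val * w.2 * (M.val * (M⁻¹).val) := by simp only [mul_assoc]
      _ = w.2 := by rw [h, one_mul, mul_one]
  exact Prod.ext rfl this

/-- The matrix of endomorphisms of `K × Mₙ(K)` whose `(i, j)` entry sends `(t, N)` to
`((p N (1 - p)) i j, 0)`. -/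
def cornerEnd (p : Matrix (Fin n) (Fin n) K) :
    Matrix (Fin n) (Fin n) (Module.End K (K × Matrix (Fin n) (Fin n) K)) :=
  Matrix.of fun i j => LinearMap.inl K K (Matrix (Fin n) (Fin n) K) ∘ₗ
    Matrix.entryLinearMap K K i j ∘ₗ LinearMap.mulLeftRight K (p, 1 - p) ∘ₗ LinearMap.snd K K _

theorem cornerEnd_apply (p : Matrix (Fin n) (Fin n) K) (i j : Fin n)
    (w : K × Matrix (Fin n) (Fin n) K) :
    cornerEnd p i j w = ((p * w.2 * (1 - p)) i j, 0) := rfl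

theorem scal_mul_apply_apply {W : Type*} [AddCommGroup W] [Module K W]
    (M : Matrix (Fin n) (Fin n) K) (x : Matrix (Fin n) (Fin n) (Module.End K W)) (i j : Fin n)
    (w : W) : (scal (Module.End K W) M * x) i j w = ∑ l, M i l • x l j w := by
  simp [scal, Matrix.mul_apply, Matrix.map_apply, LinearMap.sum_apply, Module.algebraMap_end_apply]

theorem mul_scal_apply_apply {W : Type*} [AddCommGroup W] [Module K W]
    (M : Matrix (Fin n) (Fin n) K) (x : Matrix (Fin n) (Fin n) (Module.End K W)) (i j : Fin n)
    (w : W) : (x * scal (Module.End K W) M) i j w = ∑ l, M l j • x i l w := by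
  simp [scal, Matrix.mul_apply, Matrix.map_apply, LinearMap.sum_apply, Module.algebraMap_end_apply]

theorem scal_mul_apply_of_apply_eq (M x' : Matrix (Fin n) (Fin n) K) {W : Type*} [AddCommGroup W]
    [Module K W] (x : Matrix (Fin n) (Fin n) (Module.End K (K × W))) (w : K × W)
    (hx : ∀ i j, x i j w = (x' i j, 0)) (i j : Fin n) :
    (scal (Module.End K (K × W)) M * x) i j w = ((M * x') i j, 0) := by
  rw [scal_mul_apply_apply, Matrix.mul_apply]
  simp only [hx]
  ext <;> simp [Prod.fst_sum, Prod.snd_sum]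

theorem mul_scal_apply_of_apply_eq (M x' : Matrix (Fin n) (Fin n) K) {W : Type*} [AddCommGroup W]
    [Module K W] (x : Matrix (Fin n) (Fin n) (Module.End K (K × W))) (w : K × W)
    (hx : ∀ i j, x i j w = (x' i j, 0)) (i j : Fin n) :
    (x * scal (Module.End K (K × W)) M) i j w = ((x' * M) i j, 0) := by
  rw [mul_scal_apply_apply, Matrix.mul_apply]
  simp only [hx]
  ext <;> simp [Prod.fst_sum, Prod.snd_sum, mul_comm]

/-- The block triangular matrix `g⁻¹ p + (1 - p) + b` by which `u` acts on `K × Mₙ(K)`, where `g` is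
`conjEnd M` and `b` is `cornerEnd p`. -/
def blockU (M : GL (Fin n) K) (p : Matrix (Fin n) (Fin n) K) :
    Matrix (Fin n) (Fin n) (Module.End K (K × Matrix (Fin n) (Fin n) K)) :=
  Matrix.diagonal (fun _ => conjEnd M⁻¹) * scal _ p + (1 - scal _ p) + cornerEnd p

/-- The transpose of the inverse of `blockU M p`, by which `v` acts on `K × Mₙ(K)`. -/
def blockV (M : GL (Fin n) K) (p : Matrix (Fin n) (Fin n) K) :
    Matrix (Fin n) (Fin n) (Module.End K (K × Matrix (Fin n) (Fin n) K)) :=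
  (Matrix.diagonal (fun _ => conjEnd M) * scal _ p + (1 - scal _ p) -
    Matrix.diagonal (fun _ => conjEnd M) * cornerEnd p)ᵀ

theorem relations_conjEnd_cornerEnd (F M : GL (Fin n) K) (hM : M.val = F.valᵀ)
    {p : Matrix (Fin n) (Fin n) K} (hp : p * p = p) (hpF : Commute p F.valᵀ) :
    Relations F (blockU M p) (blockV M p) := by
  have hq : (1 - p) * p = 0 := by rw [sub_mul, one_mul, hp, sub_self]
  refine relations_of_block F hp hpF (conjEnd_mul_inv M)
    (by simpa using conjEnd_mul_inv M⁻¹) ?_ ?_ ?_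
  · refine Matrix.ext fun i j => LinearMap.ext fun w => ?_
    rw [scal_mul_apply_of_apply_eq p _ _ w (fun i j => cornerEnd_apply p i j w),
      cornerEnd_apply, ← mul_assoc, ← mul_assoc, hp]
  · refine Matrix.ext fun i j => LinearMap.ext fun w => ?_
    rw [mul_scal_apply_of_apply_eq p _ _ w (fun i j => cornerEnd_apply p i j w),
      mul_assoc, hq, mul_zero]
    rfl
  · have hM' : (M⁻¹).val = (F⁻¹).valᵀ := by
      rw [Matrix.coe_units_inv, Matrix.coe_units_inv, hM, Matrix.transpose_nonsing_inv]
    have hpM : p * M.val = M.val * p := by rw [hM]; exact hpF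
    have h1 : M.val * (M⁻¹).val = 1 := by rw [← Units.val_mul, mul_inv_cancel, Units.val_one]
    have h2 : (M⁻¹).val * M.val = 1 := by rw [← Units.val_mul, inv_mul_cancel, Units.val_one]
    have hpM' : p * (M⁻¹).val = (M⁻¹).val * p := by
      calc p * (M⁻¹).val = (M⁻¹).val * (M.val * p) * (M⁻¹).val := by
            rw [← mul_assoc, h2, one_mul]
        _ = (M⁻¹).val * p := by rw [← hpM, mul_assoc, mul_assoc, h1, mul_one]
    refine Matrix.ext fun i j => LinearMap.ext fun w => ?_
    have ht : ∀ i j, (cornerEnd p)ᵀ i j w = ((p * w.2 * (1 - p))ᵀ i j, 0) :=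
      fun i j => cornerEnd_apply p j i w
    rw [mul_scal_apply_of_apply_eq _ _ _ w (scal_mul_apply_of_apply_eq _ _ _ w ht)]
    rw [Matrix.mul_diagonal, Matrix.diagonal_mul, Module.End.mul_apply, Module.End.mul_apply,
      Matrix.transpose_apply, cornerEnd_apply, conjEnd_apply, conjEnd_apply]
    refine Prod.ext ?_ (by simp)
    have : F.val * (p * w.2 * (1 - p))ᵀ * (F⁻¹).val =
        (p * ((M⁻¹).val * w.2 * M.val) * (1 - p))ᵀ := by
      rw [← Matrix.transpose_transpose F.val, ← hM, ← Matrix.transpose_transpose (F⁻¹).val, ← hM',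
        ← Matrix.transpose_mul, ← Matrix.transpose_mul]
      congr 1
      simp only [mul_sub, sub_mul, mul_one]
      simp only [mul_assoc, ← hpM]
      simp only [← mul_assoc, hpM']
    simpa using congrFun (congrFun this i) j

theorem blockU_apply_fst (M : GL (Fin n) K) (p N : Matrix (Fin n) (Fin n) K) (i j : Fin n) :
    (blockU M p i j (0, N)).1 = (p * N * (1 - p)) i j := by
  have h1 : (scal (Module.End K (K × Matrix (Fin n) (Fin n) K)) p i j (0, N)).1 = 0 := by
    simp [scal, Module.algebraMap_end_apply]
  have h2 : ((1 : Matrix (Fin n) (Fin n) (Module.End K (K × Matrix (Fin n) (Fin n) K))) i j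
      (0, N)).1 = 0 := by
    rw [Matrix.one_apply]; split_ifs <;> simp
  rw [blockU, Matrix.add_apply, Matrix.add_apply, Matrix.sub_apply, LinearMap.add_apply,
    LinearMap.add_apply, LinearMap.sub_apply, Matrix.diagonal_mul, Module.End.mul_apply,
    conjEnd_apply, cornerEnd_apply]
  simp only [Prod.fst_add, Prod.fst_sub, h1, h2]
  ring

/-- The condition is `X u = u X` in the representation of `H(F)` on `K × Mₙ(K)`, evaluated at
`(0, N)` and projected to `K`. -/
theorem mul_corner_of_commute {k : Type*} [Field k] [Algebra k K] (F : GL (Fin n) k)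
    {p : Matrix (Fin n) (Fin n) K} (hp : p * p = p)
    (hpF : Commute p (F.val.map (algebraMap k K))ᵀ)
    {X : Matrix (Fin n) (Fin n) k} (hX : Commute (scal (H F) X) (uMat F))
    (N : Matrix (Fin n) (Fin n) K) :
    X.map (algebraMap k K) * (p * N * (1 - p)) = p * N * (1 - p) * X.map (algebraMap k K) := by
  let A := Module.End K (K × Matrix (Fin n) (Fin n) K)
  let FK : GL (Fin n) K := Matrix.GeneralLinearGroup.map (algebraMap k K) F
  have hscal : ∀ Y : Matrix (Fin n) (Fin n) k, scal A (Y.map (algebraMap k K)) = scal A Y := by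
    intro Y
    refine Matrix.ext fun i j => ?_
    exact (IsScalarTower.algebraMap_apply k K A (Y i j)).symm
  obtain ⟨M, hM⟩ : ∃ M : GL (Fin n) K, M.val = FK.valᵀ :=
    ⟨⟨FK.valᵀ, (FK⁻¹).valᵀ, by rw [← Matrix.transpose_mul, ← Units.val_mul]; simp,
      by rw [← Matrix.transpose_mul, ← Units.val_mul]; simp⟩, rfl⟩
  have hK := relations_conjEnd_cornerEnd FK M hM hp hpF
  have hF : scal A FK.val = scal A F.val := hscal F.val
  have hF' : scal A (FK⁻¹).val = scal A (F⁻¹).val := by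
    rw [← hscal, ← map_inv]; rfl
  obtain ⟨r1, r2, r3, r4⟩ := hK
  rw [hF, hF'] at r3 r4
  have hk : Relations F _ _ := ⟨r1, r2, r3, r4⟩
  have hc := congrArg (fun Z : Matrix (Fin n) (Fin n) (H F) => Z.map (lift hk)) hX.eq
  simp only [Matrix.map_mul, scal_map] at hc
  rw [show (uMat F).map (lift hk) = _ from Matrix.ext fun i j => lift_u hk i j, ← hscal] at hc
  ext i j
  have h := congrArg (fun T : A => (T ((0, N) : K × Matrix (Fin n) (Fin n) K)).1)
    (congrFun (congrFun hc i) j)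
  simp only [A] at h
  rw [scal_mul_apply_apply, mul_scal_apply_apply] at h
  simp only [Prod.fst_sum, Prod.smul_fst, blockU_apply_fst, smul_eq_mul] at h
  rw [Matrix.mul_apply, Matrix.mul_apply, h]
  exact Finset.sum_congr rfl fun _ _ => mul_comm _ _

theorem mul_single_mul_apply (Y Z : Matrix (Fin n) (Fin n) K) (i s t j : Fin n) :
    (Y * Matrix.single s t (1 : K) * Z : Matrix (Fin n) (Fin n) K) i j = Y i s * Z t j := by
  simp [Matrix.mul_apply, Matrix.single_apply, ite_and]

/-- In block form for `p` and `1 - p`, the matrix `X` is upper triangular with the same scalar `c` in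
both diagonal blocks; its off-diagonal block has no trace against `M`. -/
theorem trace_mul_of_mul_corner {X p : Matrix (Fin n) (Fin n) K} (hp : p * p = p)
    (hp0 : p ≠ 0) (hp1 : p ≠ 1)
    (hX : ∀ N, X * (p * N * (1 - p)) = p * N * (1 - p) * X) :
    ∃ c : K, ∀ M, Commute p M → (M * X).trace = c * M.trace := by
  have hq : (1 - p) * (1 - p) = 1 - p := by
    rw [sub_mul, one_mul, mul_sub, mul_one, hp, sub_self, sub_zero]
  obtain ⟨a, s, has⟩ : ∃ a s, p a s ≠ 0 := by
    by_contra! h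
    exact hp0 (Matrix.ext h)
  obtain ⟨t, b, htb⟩ : ∃ t b, (1 - p) t b ≠ 0 := by
    by_contra! h
    exact hp1 (sub_eq_zero.1 (Matrix.ext h)).symm
  have hent : ∀ i s t j, (X * p) i s * (1 - p) t j = p i s * ((1 - p) * X) t j := by
    intro i s t j
    -- Take `N` to be the matrix unit at `(s, t)`.
    rw [← mul_single_mul_apply, ← mul_single_mul_apply]
    simpa only [mul_assoc] using congrFun (congrFun (hX (Matrix.single s t 1)) i) j
  obtain ⟨c, hc⟩ : ∃ c, ((1 - p) * X) t b = c * (1 - p) t b :=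
    ⟨_, (div_mul_cancel₀ _ htb).symm⟩
  have h1 : X * p = c • p := by
    ext i j
    have := hent i j t b
    rw [hc] at this
    rw [Matrix.smul_apply, smul_eq_mul]
    exact mul_right_cancel₀ htb (by rw [this]; ring)
  have h2 : (1 - p) * X = c • (1 - p) := by
    ext i j
    have := hent a s i j
    rw [h1, Matrix.smul_apply, smul_eq_mul] at this
    rw [Matrix.smul_apply, smul_eq_mul]
    exact mul_left_cancel₀ has (by rw [← this]; ring)
  refine ⟨c, fun M hM => ?_⟩
  have hM' : (1 - p) * M = M * (1 - p) := by rw [sub_mul, mul_sub, one_mul, mul_one, hM.eq]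
  calc (M * X).trace = (M * (X * p)).trace + (M * X * ((1 - p) * (1 - p))).trace := by
        rw [hq, ← Matrix.trace_add]
        congr 1
        noncomm_ring
    _ = (M * (X * p)).trace + (M * ((1 - p) * X) * (1 - p)).trace := by
        rw [← mul_assoc (M * X), Matrix.trace_mul_comm (M * X * (1 - p)), ← mul_assoc (1 - p),
          ← mul_assoc (1 - p), hM', mul_assoc M]
    _ = c * M.trace := by
        rw [h1, h2, Matrix.mul_smul, Matrix.mul_smul, Matrix.smul_mul, mul_assoc, hq,
          Matrix.trace_smul, Matrix.trace_smul, ← smul_add, ← Matrix.trace_add, ← mul_add,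
          add_sub_cancel, mul_one, smul_eq_mul]

end Representation

/-! ### Traces of matrices commuting with `u` -/

section Main
variable {K : Type*} [Field K] {n : ℕ}

theorem trace_of_isNilpotent_sub {M : Matrix (Fin n) (Fin n) K} {c : K}
    (h : IsNilpotent (M - algebraMap K _ c)) : M.trace = n * c := by
  have h0 := (Matrix.isNilpotent_trace_of_isNilpotent h).eq_zero
  rw [Matrix.trace_sub, sub_eq_zero] at h0
  rw [h0, Matrix.algebraMap_eq_diagonal]
  simp [Matrix.trace_diagonal]

theorem isNormalizable_of_isNilpotent_sub [IsAlgClosed K] (F : GL (Fin n) K) {c : K}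
    (h : IsNilpotent (F.val - algebraMap K _ c)) : IsNormalizable F := by
  have h1 := trace_of_isNilpotent_sub h
  rcases Nat.eq_zero_or_pos n with rfl | hn
  · exact isNormalizable_of_trace_eq_zero F (by simp [Matrix.trace]) (by simp [Matrix.trace])
  have : NeZero n := ⟨hn.ne'⟩
  have hc : c ≠ 0 := by
    rintro rfl
    rw [map_zero, sub_zero] at h
    exact h.not_isUnit F.isUnit
  have e : (F⁻¹).val - algebraMap K _ c⁻¹ =
      -(c⁻¹ • (F⁻¹).val) * (F.val - algebraMap K _ c) := by
    have h1 : (F⁻¹).val * F.val = 1 := by rw [← Units.val_mul, inv_mul_cancel, Units.val_one]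
    rw [Algebra.algebraMap_eq_smul_one, Algebra.algebraMap_eq_smul_one, neg_mul, mul_sub,
      Matrix.smul_mul, h1, mul_smul_comm, mul_one, smul_smul, mul_inv_cancel₀ hc, one_smul, neg_sub]
  have h2 : (F⁻¹).val.trace = n * c⁻¹ := by
    refine trace_of_isNilpotent_sub ?_
    rw [e]
    refine Commute.isNilpotent_mul_left ?_ h
    refine Commute.sub_right ?_ (Algebra.commutes _ _).symm
    exact ((Commute.refl F.val).units_inv_left.smul_left c⁻¹).neg_left
  by_cases hn0 : (n : K) = 0
  · exact isNormalizable_of_trace_eq_zero F (by rw [h1, hn0, zero_mul]) (by rw [h2, hn0, zero_mul])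
  · refine isNormalizable_of_trace_ne_zero F ?_ ?_
    · rw [h1]; exact mul_ne_zero hn0 hc
    · rw [h2]; exact mul_ne_zero hn0 (inv_ne_zero hc)

theorem trace_mul_eq_zero_of_commute {k : Type*} [Field k] [Algebra k K] [IsAlgClosed K]
    {F : GL (Fin n) k} (hF : ¬ IsNormalizable (Matrix.GeneralLinearGroup.map (algebraMap k K) F))
    {X : Matrix (Fin n) (Fin n) k} (hX : Commute (scal (H F) X) (uMat F)) {Y : GL (Fin n) k}
    (hY : Y = F ∨ Y = F⁻¹) (htr : Y.val.trace = 0) : (Y.valᵀ * X).trace = 0 := by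
  set FK : GL (Fin n) K := Matrix.GeneralLinearGroup.map (algebraMap k K) F
  rcases Nat.eq_zero_or_pos n with rfl | hn
  · simp [Matrix.trace]
  have : NeZero n := ⟨hn.ne'⟩
  obtain ⟨p, hp, hpF, hp0, hp1⟩ := (exists_idempotent_or_isNilpotent FK.val).resolve_right
    fun ⟨c, hc⟩ => hF (isNormalizable_of_isNilpotent_sub FK hc)
  have hpt : Commute pᵀ FK.valᵀ := by
    have := congrArg Matrix.transpose hpF.eq
    rw [Matrix.transpose_mul, Matrix.transpose_mul] at this
    exact this.symm
  have hpp : pᵀ * pᵀ = pᵀ := by rw [← Matrix.transpose_mul, hp]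
  obtain ⟨c, hc⟩ := trace_mul_of_mul_corner hpp (by simpa using hp0) (by simpa using hp1)
    (mul_corner_of_commute F hpp hpt hX)
  have hY' : Commute pᵀ (Y.val.map (algebraMap k K))ᵀ := by
    rcases hY with rfl | rfl
    · exact hpt
    · have h : Commute p (FK⁻¹).val := hpF.units_inv_right
      rw [← map_inv] at h
      have := congrArg Matrix.transpose h.eq
      rw [Matrix.transpose_mul, Matrix.transpose_mul] at this
      exact this.symm
  have h := hc _ hY'
  rw [Matrix.trace_transpose, ← AddMonoidHom.map_trace (algebraMap k K), htr, map_zero, mul_zero,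
    ← Matrix.transpose_map, ← Matrix.map_mul, ← AddMonoidHom.map_trace (algebraMap k K)] at h
  exact (map_eq_zero _).1 h

end Main

end Cosovereign

end

theorem corollary2p7 {k : Type*} [Field k] {K : Type*} [Field K] [IsAlgClosed K] [Algebra k K]
    {n : ℕ} (F : GL (Fin n) k)
    (hF : ¬ Cosovereign.IsNormalizable (Matrix.GeneralLinearGroup.map (algebraMap k K) F)) :
    ¬ Cosovereign.IsCosemisimple k (Cosovereign.H F) := by
  intro hH
  obtain ⟨φ, hφ1, hφr, hφl⟩ := Cosovereign.exists_haar_functional hH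
  set FK : GL (Fin n) K := Matrix.GeneralLinearGroup.map (algebraMap k K) F with hFK
  have htr : FK.val.trace = algebraMap k K F.val.trace :=
    (AddMonoidHom.map_trace (algebraMap k K) F.val).symm
  have htr' : (FK⁻¹).val.trace = algebraMap k K (F⁻¹).val.trace := by
    rw [hFK, ← map_inv]
    exact (AddMonoidHom.map_trace (algebraMap k K) (F⁻¹).val).symm
  have hne : ∀ Y : GL (Fin n) k, ¬ ∀ i j, Y.val i j = 0 := by
    intro Y hY
    have h1 : (1 : Matrix (Fin n) (Fin n) k) = 0 := by
      rw [← Units.val_one, ← mul_inv_cancel Y, Units.val_mul, show Y.val = 0 from Matrix.ext hY,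
        zero_mul]
    have h2 : ∀ Z : Matrix (Fin n) (Fin n) k, algebraMap k K Z.trace = 0 := fun Z => by
      rw [← mul_one Z, h1, mul_zero, Matrix.trace_zero, map_zero]
    exact hF (Cosovereign.isNormalizable_of_trace_eq_zero FK (htr.trans (h2 _)) (htr'.trans (h2 _)))
  refine hF (Cosovereign.isNormalizable_of_trace_ne_zero FK ?_ ?_)
  · rw [htr, _root_.map_ne_zero]
    intro h0
    refine hne F fun i m => ?_
    rw [← Cosovereign.trace_transpose_mul_integral_v_u φ hφ1 i m]
    exact Cosovereign.trace_mul_eq_zero_of_commute hF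
      (Cosovereign.commute_of_left_invariant φ hφl i m) (Or.inl rfl) h0
  · rw [htr', _root_.map_ne_zero]
    intro h0
    refine hne F⁻¹ fun j l => ?_
    rw [← Cosovereign.trace_transpose_mul_integral_u_v φ hφ1 j l]
    exact Cosovereign.trace_mul_eq_zero_of_commute hF
      (Cosovereign.commute_of_right_invariant φ hφr j l) (Or.inr rfl) h0
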